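/- **Setting.** $\Theta$ (types), $T$ (tests) and $X$ (decisions) are Polish spaces with their Borel $\sigma$-algebras, and $\Delta(Z)$ is the set of Borel probability measures on $Z$. A map $k\colon Y\to\Delta(Z)$ between Polish spaces is always understood to be a universally measurable Markov transition: for each Borel set $B\subseteq Z$ the function $y\mapsto k_y(B)$ is measurable with respect to the universal completion of the Borel $\sigma$-algebra of $Y$ (the sets that lie in the $\mu$-completion for every Borel probability measure $\mu$). The *passage rate* is a Borel function $\pi\colon T\times\Theta\to[0,1]$, $\pi(\tau\mid\theta)$ being the probability with which type $\theta$ can pass test $\tau$. The agent's utility is a Borel function $u\colon X\times\Theta\to\mathbf R$. A *social choice function* is a map $f\colon\Theta\to\Delta(X)$. **Implementation.** A *mechanism* $(M,t,g)$ consists of a Polish message space $M$, a *testing rule* $t\colon M\to\Delta(T)$ and a *decision rule* $g\colon M\times T\times\{0,1\}\to\Delta(X)$. A *strategy* $(r,e)$ consists of $r\colon\Theta\to\Delta(M)$ and a universally measurable $e\colon\Theta\times M\times T\to[0,1]$. Together they induce the social choice function $$f_\theta(B)=\int_M r_\theta(dm)\int_T t_m(d\tau)\,\Bigl[p\,g_{m,\tau,1}(B)+(1-p)\,g_{m,\tau,0}(B)\Bigr],\qquad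 p=e(\theta,m,\tau)\,\pi(\tau\mid\theta).$$ The strategy $(r,e)$ is a *best response* to $(M,t,g)$ if for each type $\theta$ the expectation of $u(\cdot,\theta)$ under the lottery induced at $\theta$ by each strategy is well defined in $[-\infty,\infty]$, and $(r,e)$ maximizes it over all strategies. The profile $(M,t,g;r,e)$ *implements* $f$ if $(r,e)$ is a best response to $(M,t,g)$ and the profile induces $f$; $f$ is *implementable* if some profile implements it. Given $\hat t\colon\Theta\to\Delta(T)$, $f$ is *canonically implementable with $\hat t$* if, for some decision rule $g$ and some strategy $(r,e)$ with $r_\theta=\delta_\theta$ and $e(\theta,\theta,\tau)=1$ for all $\theta\in\Theta$ and $\tau\in T$, the profile $(\Theta,\hat t,g;r,e)$ implements $f$. **Discernment.** Let $\pi_{\tau\mid\theta}$ be the measure on $\{0,1\}$ with mass $\pi(\tau\mid\theta)$ on $1$, and let $\ge_{\mathrm{SD}}$ denote first-order stochastic dominance. Write $\tau\succeq_\theta\psi$ if there is a Markov transition $k$ on $\{0,1\}$ with $k_1\ge_{\mathrm{SD}}k_0$, $\pi_{\tau\mid\theta}k=\pi_{\psi\mid\theta}$, and $\pi_{\tau\mid\theta'}k\le_{\mathrm{SD}}\pi_{\psi\mid\theta'}$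 for all $\theta'\ne\theta$. A correspondence $\hat T\colon\Theta\twoheadrightarrow T$ is *most discerning* if for all $\theta\in\Theta$ and $\psi\in T$ there is $\tau\in\hat T(\theta)$ with $\tau\succeq_\theta\psi$. A testing rule $\hat t\colon\Theta\to\Delta(T)$ is *supported on* $\hat T$ if $\operatorname{supp}\hat t_\theta\subseteq\hat T(\theta)$ for every $\theta$. **Theorem (Implementation with a most-discerning correspondence).** Suppose that $\pi$ is continuous. Let $\hat T\colon\Theta\twoheadrightarrow T$ be a correspondence with closed values and a Borel measurable graph $\{(\theta,\tau):\tau\in\hat T(\theta)\}$. If $\hat T$ is most discerning, then for every implementable social choice function $f$ there exists a testing rule $\hat t$ supported on $\hat T$ such that $f$ is canonically implementable with $\hat t$. -/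

import Mathlib

open MeasureTheory ProbabilityTheory Set
open scoped ENNReal

universe uΘ uT uX uM

namespace TestingMechanism

/-! ### Universal measurability -/

/-- The universal completion of a σ-algebra: the sets that, for every probability measure `μ` on
the original σ-algebra, belong to its `μ`-completion. -/
abbrev universalCompletion (α : Type*) [MeasurableSpace α] : MeasurableSpace α where
  MeasurableSet' s := ∀ μ : Measure α, IsProbabilityMeasure μ → NullMeasurableSet s μ
  measurableSet_empty _ _ := nullMeasurableSet_empty
  measurableSet_compl _ hs μ hμ := (hs μ hμ).compl
  measurableSet_iUnion _ hs μ hμ := .iUnion fun i => hs i μ hμ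

/-- Measurability with respect to the universal completion of the σ-algebra of the domain. -/
def UniversallyMeasurable {α β : Type*} [MeasurableSpace α] [MeasurableSpace β]
    (f : α → β) : Prop :=
  @Measurable α β (universalCompletion α) _ f

section

variable {α β γ : Type*} [MeasurableSpace α] [MeasurableSpace β] [MeasurableSpace γ]

theorem universallyMeasurable_iff {f : α → β} :
    UniversallyMeasurable f ↔ ∀ μ : Measure α, IsProbabilityMeasure μ → NullMeasurable f μ :=
  ⟨fun h μ hμ _ hs => h hs μ hμ, fun h _ hs μ hμ => h μ hμ hs⟩

theorem _root_.Measurable.universallyMeasurable {f : α → β} (hf : Measurable f) :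
    UniversallyMeasurable f :=
  universallyMeasurable_iff.2 fun _ _ => hf.nullMeasurable

theorem UniversallyMeasurable.comp_measurable {g : β → γ} {f : α → β}
    (hg : UniversallyMeasurable g) (hf : Measurable f) :
    UniversallyMeasurable fun a => g (f a) := by
  intro s hs μ hμ
  have := Measure.isProbabilityMeasure_map (μ := μ) hf.aemeasurable
  exact (hg hs (μ.map f) this).preimage (hf.quasiMeasurePreserving μ)

end

/-! ### Markov transitions -/

/-- A Markov transition `α → Δ(β)`: each value is a probability measure on the given σ-algebra of
`β` (the Borel σ-algebra in the model), and the probability of each measurable set is a universally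
measurable function of the source point. -/
@[ext]
structure Transition (α β : Type*) [MeasurableSpace α] [MeasurableSpace β] where
  /-- The measure assigned to each point. -/
  toFun : α → Measure β
  isProb' : ∀ a, IsProbabilityMeasure (toFun a)
  univMeas' : ∀ B, MeasurableSet B → UniversallyMeasurable fun a => toFun a B

namespace Transition

variable {α β γ : Type*} [MeasurableSpace α] [MeasurableSpace β] [MeasurableSpace γ]

instance : CoeFun (Transition α β) fun _ => α → Measure β := ⟨toFun⟩

instance (k : Transition α β) (a : α) : IsProbabilityMeasure (k a) := k.isProb' a

/-- The identity transition, sending `a` to the point mass at `a`. -/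
noncomputable def id (α : Type*) [MeasurableSpace α] : Transition α α where
  toFun := Measure.dirac
  isProb' _ := inferInstance
  univMeas' _ hB := (Measure.measurable_coe hB |>.comp Measure.measurable_dirac)
    |>.universallyMeasurable

/-- Precomposition of a transition with a measurable map. -/
def comap (k : Transition β γ) (f : α → β) (hf : Measurable f) : Transition α γ where
  toFun a := k (f a)
  isProb' _ := inferInstance
  univMeas' B hB := (k.univMeas' B hB).comp_measurable hf

/-- For each probability measure `μ` on the source, a transition agrees `μ`-almost everywhere with
a kernel that is measurable for the original σ-algebra. -/
theorem exists_kernel [MeasurableSpace.CountablyGenerated β] (k : Transition α β)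
    (μ : Measure α) [IsProbabilityMeasure μ] :
    ∃ κ : Kernel α β, IsMarkovKernel κ ∧ ∀ᵐ a ∂μ, k a = κ a := by
  classical
  let G : ℕ → Set β := MeasurableSpace.natGeneratingSequence β
  have hG : ∀ n, MeasurableSet (G n) := MeasurableSpace.measurableSet_natGeneratingSequence
  let S : Finset ℕ → Set β := fun F => ⋂ i ∈ F, G i
  have hS : ∀ F, MeasurableSet (S F) := fun F => F.measurableSet_biInter fun i _ => hG i
  have hae : ∀ F, AEMeasurable (fun a => k a (S F)) μ := fun F =>
    (universallyMeasurable_iff.1 (k.univMeas' _ (hS F)) μ inferInstance).aemeasurable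
  have hall : ∀ᵐ a ∂μ, ∀ F, k a (S F) = (hae F).mk _ a :=
    ae_all_iff.2 fun F => (hae F).ae_eq_mk
  obtain ⟨N, hNsub, hN, hN0⟩ := exists_measurable_superset_of_null hall
  have hout : ∀ a, a ∉ N → ∀ F, k a (S F) = (hae F).mk _ a := by
    intro a ha
    by_contra h
    exact ha (hNsub h)
  obtain ⟨a₀⟩ : Nonempty α := nonempty_of_isProbabilityMeasure μ
  let f : α → Measure β := N.piecewise (fun _ => k a₀) k
  have hfP : ∀ a, IsProbabilityMeasure (f a) := by
    intro a
    by_cases ha : a ∈ N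
    · simp only [f, Set.piecewise_eq_of_mem _ _ _ ha]; infer_instance
    · simp only [f, Set.piecewise_eq_of_notMem _ _ _ ha]; infer_instance
  have hgen : ‹MeasurableSpace β› = MeasurableSpace.generateFrom (Set.range S) := by
    apply le_antisymm
    · conv_lhs => rw [← MeasurableSpace.generateFrom_natGeneratingSequence β]
      refine MeasurableSpace.generateFrom_mono ?_
      rintro _ ⟨n, rfl⟩
      exact ⟨{n}, by simp [S, G]⟩
    · refine MeasurableSpace.generateFrom_le ?_
      rintro _ ⟨F, rfl⟩
      exact hS F
  have hpi : IsPiSystem (Set.range S) := by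
    rintro _ ⟨F, rfl⟩ _ ⟨F', rfl⟩ _
    refine ⟨F ∪ F', ?_⟩
    ext x
    simp only [S, Set.mem_iInter, Set.mem_inter_iff, Finset.mem_union]
    exact ⟨fun h => ⟨fun i hi => h i (.inl hi), fun i hi => h i (.inr hi)⟩,
      fun h i hi => hi.elim (h.1 i) (h.2 i)⟩
  have hfm : Measurable f := by
    refine Measurable.measure_of_isPiSystem_of_isProbabilityMeasure hgen hpi ?_
    rintro _ ⟨F, rfl⟩
    have : (fun a => f a (S F)) = N.piecewise (fun _ => k a₀ (S F)) ((hae F).mk _) := by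
      ext a
      by_cases ha : a ∈ N
      · simp [f, ha]
      · simp [f, ha, hout a ha F]
    rw [this]
    exact Measurable.piecewise hN measurable_const (hae F).measurable_mk
  refine ⟨⟨f, hfm⟩, ⟨hfP⟩, ?_⟩
  filter_upwards [measure_eq_zero_iff_ae_notMem.1 hN0] with a ha
  simp [f, ha]

theorem aemeasurable [MeasurableSpace.CountablyGenerated β] (k : Transition α β)
    (μ : Measure α) [IsProbabilityMeasure μ] : AEMeasurable k.toFun μ := by
  obtain ⟨κ, -, h⟩ := k.exists_kernel μ
  exact ⟨κ, κ.measurable, h⟩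

theorem universallyMeasurable_lintegral [MeasurableSpace.CountablyGenerated β]
    (k : Transition α β) {H : α × β → ℝ≥0∞} (hH : UniversallyMeasurable H) :
    UniversallyMeasurable fun a => ∫⁻ b, H (a, b) ∂(k a) := by
  refine universallyMeasurable_iff.2 fun μ hμ => ?_
  obtain ⟨κ, hκ, hk⟩ := k.exists_kernel μ
  have hae : AEMeasurable H (μ.compProd κ) :=
    (universallyMeasurable_iff.1 hH _ inferInstance).aemeasurable
  have h1 := Measure.ae_ae_of_ae_compProd hae.ae_eq_mk
  have hm : Measurable fun a => ∫⁻ b, hae.mk H (a, b) ∂(κ a) :=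
    hae.measurable_mk.lintegral_kernel_prod_right'
  refine hm.nullMeasurable.congr ?_
  filter_upwards [h1, hk] with a ha hka
  rw [hka]
  exact lintegral_congr_ae (ha.mono fun b hb => hb.symm)

/-- The composition `k l : α → Δ(γ)` of `k : α → Δ(β)` and `l : β → Δ(γ)`. -/
noncomputable def comp [MeasurableSpace.CountablyGenerated β]
    [MeasurableSpace.CountablyGenerated γ] (k : Transition α β) (l : Transition β γ) :
    Transition α γ where
  toFun a := (k a).bind l
  isProb' a := isProbabilityMeasure_bind (l.aemeasurable _) (.of_forall fun _ => inferInstance)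
  univMeas' B hB := by
    have h := k.universallyMeasurable_lintegral
      ((l.univMeas' B hB).comp_measurable (measurable_snd (α := α) (β := β)))
    convert! h using 2 with a
    exact Measure.bind_apply hB (l.aemeasurable _)

theorem comp_apply [MeasurableSpace.CountablyGenerated β]
    [MeasurableSpace.CountablyGenerated γ] (k : Transition α β) (l : Transition β γ) (a : α)
    {C : Set γ} (hC : MeasurableSet C) : (k.comp l) a C = ∫⁻ b, l b C ∂(k a) :=
  Measure.bind_apply hC (l.aemeasurable _)

theorem aemeasurable_map_prodMk [MeasurableSpace.CountablyGenerated γ]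
    (l : Transition (α × β) γ) (a : α) (μ : Measure β) [IsProbabilityMeasure μ] :
    AEMeasurable (fun b => (l (a, b)).map (Prod.mk b)) μ := by
  obtain ⟨κ, hκ, hl⟩ := (l.comap (Prod.mk a) measurable_prodMk_left).exists_kernel μ
  refine ⟨fun b => (Kernel.id ×ₖ κ) b, Kernel.measurable _, ?_⟩
  filter_upwards [hl] with b hb
  have hb' : l (a, b) = κ b := hb
  rw [Kernel.prod_apply, Kernel.id_apply, Measure.dirac_prod, hb']

theorem univMeas_section [MeasurableSpace.CountablyGenerated γ]
    (l : Transition (α × β) γ) {D : Set (β × γ)} (hD : MeasurableSet D) :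
    UniversallyMeasurable fun p : α × β => l p (Prod.mk p.2 ⁻¹' D) := by
  refine universallyMeasurable_iff.2 fun μ hμ => ?_
  obtain ⟨κ, hκ, hl⟩ := l.exists_kernel μ
  have hE : MeasurableSet {q : (α × β) × γ | (q.1.2, q.2) ∈ D} :=
    (measurable_fst.snd.prodMk measurable_snd) hD
  refine (Kernel.measurable_kernel_prodMk_left (κ := κ) hE).nullMeasurable.congr ?_
  filter_upwards [hl] with p hp
  rw [hp]
  rfl

/-- The product `k × l : α → Δ(β × γ)` of `k : α → Δ(β)` and `l : α × β → Δ(γ)`: first `b` is drawn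
from `k a`, then `c` is drawn from `l (a, b)`, and the pair `(b, c)` is returned. -/
noncomputable def prod [MeasurableSpace.CountablyGenerated β]
    [MeasurableSpace.CountablyGenerated γ] (k : Transition α β) (l : Transition (α × β) γ) :
    Transition α (β × γ) where
  toFun a := (k a).bind fun b => (l (a, b)).map (Prod.mk b)
  isProb' a := isProbabilityMeasure_bind (l.aemeasurable_map_prodMk a _)
    (.of_forall fun _ => Measure.isProbabilityMeasure_map measurable_prodMk_left.aemeasurable)
  univMeas' D hD := by
    have h := k.universallyMeasurable_lintegral (l.univMeas_section hD)
    convert! h using 2 with a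
    rw [Measure.bind_apply hD (l.aemeasurable_map_prodMk a _)]
    exact lintegral_congr fun b => Measure.map_apply measurable_prodMk_left hD

theorem prod_apply [MeasurableSpace.CountablyGenerated β]
    [MeasurableSpace.CountablyGenerated γ] (k : Transition α β) (l : Transition (α × β) γ)
    (a : α) {D : Set (β × γ)} (hD : MeasurableSet D) :
    (k.prod l) a D = ∫⁻ b, l (a, b) (Prod.mk b ⁻¹' D) ∂(k a) := by
  refine (Measure.bind_apply hD (l.aemeasurable_map_prodMk a _)).trans ?_
  exact lintegral_congr fun b => Measure.map_apply measurable_prodMk_left hD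

end Transition

/-! ### Tests and discernment -/

/-- The law on scores (`true` is pass, `false` is fail) that puts probability `p` on pass. -/
noncomputable def scoreLaw (p : unitInterval) : Measure Bool := bernoulliMeasure true false p

theorem measurable_scoreLaw_apply (B : Set Bool) : Measurable fun p : unitInterval => scoreLaw p B := by
  classical
  have h : ∀ p : unitInterval, scoreLaw p B =
      unitInterval.toNNReal p * Measure.dirac true B
        + unitInterval.toNNReal (unitInterval.symm p) * Measure.dirac false B := fun _ => rfl
  simp_rw [h]
  have h1 : Measurable unitInterval.toNNReal := unitInterval.toNNReal_continuous.measurable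
  have h2 : Measurable unitInterval.symm := unitInterval.continuous_symm.measurable
  fun_prop

instance (p : unitInterval) : IsProbabilityMeasure (scoreLaw p) := by
  unfold scoreLaw; infer_instance

/-- First-order stochastic dominance `μ ≥_SD ν`: the distribution function of `μ` lies below that
of `ν`. -/
def StochDominates {S : Type*} [Preorder S] [MeasurableSpace S] (μ ν : Measure S) : Prop :=
  ∀ s, μ (Iic s) ≤ ν (Iic s)

/-- A kernel on an ordered set is monotone if higher scores are sent to dominating laws. -/
def MonotoneKernel {S : Type*} [Preorder S] [MeasurableSpace S] (k : Kernel S S) : Prop :=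
  ∀ s t, t < s → StochDominates (k s) (k t)

/-- A passage rate `π : T × Θ → [0,1]`, Borel measurable: `passage (τ, θ)` is the probability with
which type `θ` passes test `τ` when exerting effort. -/
structure PassageRate (Θ T : Type*) [MeasurableSpace Θ] [MeasurableSpace T] where
  /-- The passage probability of a (test, type) pair. -/
  passage : T × Θ → unitInterval
  measurable_passage : Measurable passage

variable {Θ T X M : Type*}

/-- `τ ⪰_θ ψ`: the test `τ` is more `θ`-discerning than the test `ψ`. -/
def MoreDiscerning [MeasurableSpace Θ] [MeasurableSpace T] (π : PassageRate Θ T)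
    (θ : Θ) (τ ψ : T) : Prop :=
  ∃ k : Kernel Bool Bool, IsMarkovKernel k ∧ MonotoneKernel k ∧
    (scoreLaw (π.passage (τ, θ))).bind k = scoreLaw (π.passage (ψ, θ)) ∧
    ∀ θ', θ' ≠ θ → StochDominates (scoreLaw (π.passage (ψ, θ')))
      ((scoreLaw (π.passage (τ, θ'))).bind k)

/-- A correspondence `Θ ↠ T` is most discerning if, for each type `θ`, every test `ψ` admits a
test in the value at `θ` that is more `θ`-discerning than `ψ`. -/
def MostDiscerning [MeasurableSpace Θ] [MeasurableSpace T] (π : PassageRate Θ T)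
    (That : Θ → Set T) : Prop :=
  ∀ θ, ∀ ψ : T, ∃ τ ∈ That θ, MoreDiscerning π θ τ ψ

/-! ### Mechanisms, strategies and implementation -/

section Game

variable [MeasurableSpace Θ] [MeasurableSpace T] [MeasurableSpace X] [MeasurableSpace M]

/-- A mechanism with message space `M`: a testing rule `M → Δ(T)` and a decision rule
`M × T × {0,1} → Δ(X)`. -/
structure Mechanism (T X M : Type*) [MeasurableSpace T] [MeasurableSpace X]
    [MeasurableSpace M] where
  /-- The testing rule. -/
  testing : Transition M T
  /-- The decision rule. -/
  decision : Transition (M × T × Bool) X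

/-- A strategy of the agent: a reporting strategy `Θ → Δ(M)` and an effort strategy
`Θ × M × T → [0,1]`. -/
structure Strategy (Θ T M : Type*) [MeasurableSpace Θ] [MeasurableSpace T]
    [MeasurableSpace M] where
  /-- The reporting strategy. -/
  report : Transition Θ M
  /-- The probability of exerting effort. -/
  effort : Θ × M × T → unitInterval
  univMeas_effort : UniversallyMeasurable effort

/-- The law of the test result, given the type, the message, and the test: the test is passed with
probability (effort probability) × (passage rate). -/
noncomputable def Strategy.score (π : PassageRate Θ T) (σ : Strategy Θ T M) :
    Transition (Θ × M × T) Bool where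
  toFun h := scoreLaw (σ.effort h * π.passage (h.2.2, h.1))
  isProb' _ := inferInstance
  univMeas' B _ := by
    have hp : UniversallyMeasurable fun h : Θ × M × T => π.passage (h.2.2, h.1) :=
      (π.measurable_passage.comp
        (measurable_snd.snd.prodMk measurable_fst)).universallyMeasurable
    have hmul : UniversallyMeasurable fun h : Θ × M × T =>
        σ.effort h * π.passage (h.2.2, h.1) :=
      @Measurable.mul _ _ _ _ (universalCompletion _) _ _ _ σ.univMeas_effort hp
    exact (measurable_scoreLaw_apply B).comp hmul

section

variable [MeasurableSpace.CountablyGenerated T] [MeasurableSpace.CountablyGenerated X]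
  [MeasurableSpace.CountablyGenerated M]

/-- The social choice function `(r × t × (e π)) g` induced by a mechanism and a strategy. -/
noncomputable def induced (π : PassageRate Θ T) (mech : Mechanism T X M) (σ : Strategy Θ T M) :
    Transition Θ X :=
  ((σ.report.prod (mech.testing.comap Prod.snd measurable_snd)).prod (σ.score π)).comp
    (mech.decision.comap MeasurableEquiv.prodAssoc MeasurableEquiv.prodAssoc.measurable)

/-- The expectation of `w` under `ν` is well defined in `[-∞, ∞]`: the positive part or the negative
part has finite integral. -/
def HasExpectation (ν : Measure X) (w : X → ℝ) : Prop :=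
  ∫⁻ x, ENNReal.ofReal (w x) ∂ν ≠ ⊤ ∨ ∫⁻ x, ENNReal.ofReal (-w x) ∂ν ≠ ⊤

/-- The expectation of `w` under `ν`, in `[-∞, ∞]`; meaningful under `HasExpectation`. -/
noncomputable def expectation (ν : Measure X) (w : X → ℝ) : EReal :=
  ((∫⁻ x, ENNReal.ofReal (w x) ∂ν : ℝ≥0∞) : EReal)
    - ((∫⁻ x, ENNReal.ofReal (-w x) ∂ν : ℝ≥0∞) : EReal)

/-- `σ` is a best response to `mech`: for every type, the expected utility of each strategy is well
defined, and `σ` maximizes it over all strategies. -/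
def IsBestResponse (π : PassageRate Θ T) (u : X × Θ → ℝ) (mech : Mechanism T X M)
    (σ : Strategy Θ T M) : Prop :=
  ∀ (σ' : Strategy Θ T M) (θ : Θ),
    HasExpectation (induced π mech σ' θ) (fun x => u (x, θ)) ∧
    expectation (induced π mech σ' θ) (fun x => u (x, θ)) ≤
      expectation (induced π mech σ θ) (fun x => u (x, θ))

/-- The profile `(mech; σ)` implements `f`: it is incentive compatible and induces `f`. -/
def Implements (π : PassageRate Θ T) (u : X × Θ → ℝ) (mech : Mechanism T X M)
    (σ : Strategy Θ T M) (f : Transition Θ X) : Prop :=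
  IsBestResponse π u mech σ ∧ f = induced π mech σ

end

/-- A strategy in a direct mechanism (message space `Θ`) is canonical if the report is truthful and
effort is exerted on every test after the truthful report. -/
def Strategy.IsCanonical (σ : Strategy Θ T Θ) : Prop :=
  σ.report = Transition.id Θ ∧ ∀ θ τ, σ.effort (θ, θ, τ) = 1

/-- `f` is implementable: some profile, with some Polish message space, implements it. -/
def Implementable {Θ : Type uΘ} {T : Type uT} {X : Type uX}
    [MeasurableSpace Θ] [MeasurableSpace T] [MeasurableSpace X]
    [MeasurableSpace.CountablyGenerated T] [MeasurableSpace.CountablyGenerated X]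
    (π : PassageRate Θ T) (u : X × Θ → ℝ) (f : Transition Θ X) : Prop :=
  ∃ (M : Type uM) (_ : TopologicalSpace M) (_ : PolishSpace M) (_ : MeasurableSpace M)
    (_ : BorelSpace M) (mech : Mechanism T X M) (σ : Strategy Θ T M), Implements π u mech σ f

/-- `f` is canonically implementable with the testing rule `t`: there are a decision rule `g` and a
canonical strategy such that the resulting profile of the direct mechanism `(t, g)` implements
`f`. -/
def CanonicallyImplementableWith [MeasurableSpace.CountablyGenerated Θ]
    [MeasurableSpace.CountablyGenerated T] [MeasurableSpace.CountablyGenerated X]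
    (π : PassageRate Θ T) (u : X × Θ → ℝ) (t : Transition Θ T) (f : Transition Θ X) : Prop :=
  ∃ (g : Transition (Θ × T × Bool) X) (σ : Strategy Θ T Θ),
    σ.IsCanonical ∧ Implements π u ⟨t, g⟩ σ f

end Game

/-- A testing rule `t : Θ → Δ(T)` is supported on the correspondence `That` if the support of
`t θ` is contained in `That θ` for every type `θ`. -/
def SupportedOn [MeasurableSpace Θ] [TopologicalSpace T] [MeasurableSpace T]
    (t : Transition Θ T) (That : Θ → Set T) : Prop :=
  ∀ θ, (t θ).support ⊆ That θ

end TestingMechanism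

open TestingMechanism

/-!
Fix a profile that implements `f`, with messages in `M`, and turn it into a direct mechanism. Upon
the report `θ`, draw a message and a test `ψ` as the original profile does at `θ`, but administer a
test `τ = s (θ, ψ)` from the correspondence that is more `θ`-discerning than `ψ`. Convert the score
on `τ` into a score on `ψ` (a pass stays a pass with probability `a (θ, ψ)`, a fail becomes one with
probability `b (θ, ψ) ≤ a (θ, ψ)`), uphold a converted pass with the original effort probability,
and apply the original decision rule.

* If type `θ` is truthful and exerts effort, the converted score has exactly its original law, so
  `f` is induced.
* If type `θ'` reports `θ`, its probability of a converted pass is at most `π(ψ | θ')` whatever its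
  effort. Hence it could obtain the same lottery in the original mechanism, by imitating the
  messages of the reported types and exerting effort with a suitable probability; as that
  probability may not depend on the report, it is averaged conditionally on the message and the
  test (`exists_strategy_induced_eq`, through `exists_lintegral_lottery_eq`). So no deviation is
  profitable, and all expectations stay well defined.

Two measurability points carry the construction. First, `s`, `a` and `b` are chosen jointly and
universally measurably: by continuity of the passage rate the relation `τ ⪰_θ ψ` involves only a
countable dense set of types, so it is the projection of a Borel set in `(θ, ψ, τ, a, b)`, and the
Jankov–von Neumann theorem applies (`exists_universallyMeasurable_selection`, which rests on the
universal measurability of analytic sets). Second, the decision rule sees only the report, `τ` and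
the score, so the message and `ψ` are redrawn from their conditional law given `τ`, which is
universally measurable in the report by disintegration of kernels whose source carries the universal
completion (`Transition.exists_eq_prod`).
-/

open TestingMechanism

/-! ### Analytic sets are universally measurable -/

section Analytic

open Filter Topology

/-- An open neighbourhood of the compact box of sequences bounded by `n` contains all sequences of
which only a sufficiently long initial segment is bounded by `n`. -/
theorem exists_boundedPrefix_subset_of_isOpen {n : ℕ → ℕ} {V : Set (ℕ → ℕ)} (hV : IsOpen V)
    (hn : {y : ℕ → ℕ | ∀ i, y i ≤ n i} ⊆ V) :
    ∃ k, {y : ℕ → ℕ | ∀ i < k, y i ≤ n i} ⊆ V := by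
  by_contra! h
  simp only [not_subset] at h
  choose y hy hyV using h
  have hK : IsCompact {y : ℕ → ℕ | ∀ i, y i ≤ n i} := by
    have : {y : ℕ → ℕ | ∀ i, y i ≤ n i} = univ.pi fun i => Iic (n i) := by
      ext; simp [Pi.le_def]
    rw [this]
    exact isCompact_univ_pi fun i => (finite_Iic _).isCompact
  obtain ⟨z, hz, φ, hφ, hlim⟩ := hK.tendsto_subseq (x := fun k i => min (y k i) (n i))
    fun k i => min_le_right _ _
  -- Truncating `y k` at `n` changes no coordinate below `k`, so the limit is the same.
  have hlim' : Tendsto (y ∘ φ) atTop (𝓝 z) := by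
    rw [tendsto_pi_nhds] at hlim ⊢
    intro i
    refine (hlim i).congr' ?_
    filter_upwards [eventually_gt_atTop i] with k hk
    exact min_eq_left (hy _ _ (hk.trans_le hφ.le_apply))
  exact hV.isClosed_compl.mem_of_tendsto hlim' (.of_forall fun k => hyV _) (hn hz)

/-- Inner approximation of a continuous image of the Baire space by compact sets: bounding the
coordinates one after the other loses arbitrarily little outer measure. -/
theorem exists_isCompact_subset_range_le_measure {α : Type*} [TopologicalSpace α]
    [MeasurableSpace α] (μ : Measure α) [μ.OuterRegular]
    {f : (ℕ → ℕ) → α} (hf : Continuous f) {a : ℝ≥0∞} (ha : a < μ (range f)) :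
    ∃ K ⊆ range f, IsCompact K ∧ a ≤ μ K := by
  have step : ∀ (k : ℕ) (S : {S : Set (ℕ → ℕ) // a < μ (f '' S)}),
      ∃ m : ℕ, a < μ (f '' (S.1 ∩ {y | y k ≤ m})) := by
    rintro k ⟨S, hS⟩
    have hU : f '' S = ⋃ m : ℕ, f '' (S ∩ {y | y k ≤ m}) := by
      rw [← image_iUnion, ← inter_iUnion]
      congr 1
      refine (inter_eq_left.2 fun y _ => ?_).symm
      exact mem_iUnion.2 ⟨y k, le_refl (y k)⟩
    have hdir : Monotone fun m : ℕ => f '' (S ∩ {y | y k ≤ m}) := fun m m' h =>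
      image_mono (inter_subset_inter_right _ fun y (hy : y k ≤ m) => hy.trans h)
    rw [hU, hdir.measure_iUnion] at hS
    exact lt_iSup_iff.1 hS
  choose c hc using step
  let S : ℕ → {S : Set (ℕ → ℕ) // a < μ (f '' S)} :=
    fun k => Nat.rec ⟨univ, by simpa using ha⟩ (fun k S => ⟨S.1 ∩ {y | y k ≤ c k S}, hc k S⟩) k
  let n : ℕ → ℕ := fun k => c k (S k)
  have hS : ∀ k, (S k).1 = {y | ∀ i < k, y i ≤ n i} := by
    intro k
    induction k with
    | zero => ext; simp [S]
    | succ k ih =>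
      have : (S (k + 1)).1 = (S k).1 ∩ {y | y k ≤ n k} := rfl
      rw [this, ih]
      ext y
      exact Nat.forall_lt_succ_right.symm
  have hK : IsCompact {y : ℕ → ℕ | ∀ i, y i ≤ n i} := by
    have : {y : ℕ → ℕ | ∀ i, y i ≤ n i} = univ.pi fun i => Iic (n i) := by
      ext; simp [Pi.le_def]
    rw [this]
    exact isCompact_univ_pi fun i => (finite_Iic _).isCompact
  refine ⟨f '' {y : ℕ → ℕ | ∀ i, y i ≤ n i}, image_subset_range _ _, hK.image hf, ?_⟩
  rw [Set.measure_eq_iInf_isOpen]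
  refine le_iInf₂ fun U hU => le_iInf fun hUo => ?_
  obtain ⟨k, hk⟩ := exists_boundedPrefix_subset_of_isOpen (hUo.preimage hf) (image_subset_iff.1 hU)
  refine (S k).2.le.trans (measure_mono ?_)
  rw [hS, image_subset_iff]
  exact hk

/-- Analytic sets are measurable for the completion of every finite outer regular measure. -/
theorem MeasureTheory.AnalyticSet.nullMeasurableSet {α : Type*} [TopologicalSpace α]
    [T2Space α] [MeasurableSpace α] [OpensMeasurableSpace α] {s : Set α} (hs : AnalyticSet s)
    (μ : Measure α) [IsFiniteMeasure μ] [μ.OuterRegular] : NullMeasurableSet s μ := by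
  rw [AnalyticSet] at hs
  rcases hs with rfl | ⟨f, hf, rfl⟩
  · exact nullMeasurableSet_empty
  rcases eq_or_ne (μ (range f)) 0 with h0 | h0
  · exact NullMeasurableSet.of_null h0
  obtain ⟨a, -, ha, hlim⟩ := exists_seq_strictMono_tendsto' (pos_iff_ne_zero.2 h0)
  choose K hK hKc haK using fun k => exists_isCompact_subset_range_le_measure μ hf (ha k).2
  have hm : MeasurableSet (⋃ k, K k) := .iUnion fun k => (hKc k).measurableSet
  refine hm.nullMeasurableSet.congr
    (ae_eq_of_subset_of_measure_ge (iUnion_subset hK) ?_ hm.nullMeasurableSet (measure_ne_top _ _))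
  exact le_of_tendsto' hlim fun k => (haK k).trans (measure_mono (subset_iUnion K k))

theorem MeasureTheory.AnalyticSet.measurableSet_universalCompletion {α : Type*}
    [TopologicalSpace α] [PolishSpace α] [MeasurableSpace α] [BorelSpace α] {s : Set α}
    (hs : AnalyticSet s) : MeasurableSet[universalCompletion α] s := by
  intro μ hμ
  let := TopologicalSpace.upgradeIsCompletelyMetrizable α
  exact hs.nullMeasurableSet μ

/-! ### Universally measurable selection -/

/-- The sequences of natural numbers that extend a given finite sequence, which is listed from its
last entry to its first. -/
def baireCylinder : List ℕ → Set (ℕ → ℕ)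
  | [] => univ
  | j :: l => baireCylinder l ∩ {y | y l.length = j}

theorem isOpen_baireCylinder : ∀ l, IsOpen (baireCylinder l)
  | [] => isOpen_univ
  | j :: l => (isOpen_baireCylinder l).inter
      ((isOpen_discrete ({j} : Set ℕ)).preimage
        (continuous_apply (A := fun _ : ℕ => ℕ) l.length))

/-- A continuous surjection from the Baire space onto a Polish space has a universally measurable
right inverse: send each point to the leftmost branch of its fibre. -/
theorem exists_universallyMeasurable_rightInverse {α : Type*} [TopologicalSpace α]
    [PolishSpace α] [MeasurableSpace α] [BorelSpace α] {p : (ℕ → ℕ) → α} (hp : Continuous p)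
    (hsurj : Function.Surjective p) :
    ∃ h : α → ℕ → ℕ, UniversallyMeasurable h ∧ ∀ x, p (h x) = x := by
  classical
  have hex : ∀ (x : α) (l : {l : List ℕ // x ∈ p '' baireCylinder l}),
      ∃ j, x ∈ p '' baireCylinder (j :: l.1) := by
    rintro x ⟨l, y, hy, rfl⟩
    exact ⟨y l.length, y, ⟨hy, rfl⟩, rfl⟩
  -- `c x n` is the initial segment of length `n` of the leftmost branch of the fibre of `x`.
  let c : ∀ x, ℕ → {l : List ℕ // x ∈ p '' baireCylinder l} := fun x n =>
    Nat.rec ⟨[], by simpa [baireCylinder] using hsurj x⟩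
      (fun _ l => ⟨Nat.find (hex x l) :: l.1, Nat.find_spec (hex x l)⟩) n
  have hc : ∀ x n, (c x (n + 1)).1 = Nat.find (hex x (c x n)) :: (c x n).1 := fun _ _ => rfl
  have hlen : ∀ x n, (c x n).1.length = n := by
    intro x n
    induction n with
    | zero => rfl
    | succ n ih => rw [hc, List.length_cons, ih]
  let h : α → ℕ → ℕ := fun x n => Nat.find (hex x (c x n))
  have hmem : ∀ x n y, y ∈ baireCylinder (c x n).1 → ∀ i < n, y i = h x i := by
    intro x n
    induction n with
    | zero => intro y _ i hi; omega
    | succ n ih =>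
      intro y hy i hi
      rw [hc] at hy
      rcases Nat.lt_succ_iff_lt_or_eq.1 hi with hi | rfl
      · exact ih y hy.1 i hi
      · have := hy.2
        rwa [mem_ofPred_eq, hlen] at this
  refine ⟨h, ?_, fun x => ?_⟩
  · have hfib : ∀ l, MeasurableSet[universalCompletion α] (p '' baireCylinder l) := fun l =>
      ((isOpen_baireCylinder l).analyticSet_image hp).measurableSet_universalCompletion
    have hbranch : ∀ n l, MeasurableSet[universalCompletion α] {x | (c x n).1 = l} := by
      intro n
      induction n with
      | zero => exact fun l => @MeasurableSet.const _ (universalCompletion α) ([] = l)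
      | succ n ih =>
        rintro (_ | ⟨j, l⟩)
        · simp [hc]
        · have : {x | (c x (n + 1)).1 = j :: l} = {x | (c x n).1 = l} ∩
              (p '' baireCylinder (j :: l) ∩ ⋂ i < j, (p '' baireCylinder (i :: l))ᶜ) := by
            ext x
            simp only [hc, List.cons.injEq, Nat.find_eq_iff, mem_inter_iff, mem_iInter₂,
              mem_compl_iff, mem_ofPred_eq]
            constructor
            · rintro ⟨hj, rfl⟩
              exact ⟨rfl, hj⟩
            · rintro ⟨rfl, hj⟩
              exact ⟨hj, rfl⟩
          rw [this]
          refine @MeasurableSet.inter _ (universalCompletion α) _ _ (ih l)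
            (@MeasurableSet.inter _ (universalCompletion α) _ _ (hfib _) ?_)
          exact @MeasurableSet.iInter _ _ (universalCompletion α) _ _ fun i =>
            @MeasurableSet.iInter _ _ (universalCompletion α) _ _ fun _ =>
              @MeasurableSet.compl _ _ (universalCompletion α) (hfib _)
    refine @measurable_pi_lambda _ _ _ (universalCompletion α) _ _ fun n => ?_
    refine @measurable_to_countable' _ _ _ _ (universalCompletion α) _ fun j => ?_
    have : (fun x => h x n) ⁻¹' {j} = ⋃ l, {x | (c x (n + 1)).1 = j :: l} := by
      ext x
      simp [hc, h]
    rw [this]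
    exact @MeasurableSet.iUnion _ _ (universalCompletion α) _ _ fun l => hbranch (n + 1) (j :: l)
  · -- The leftmost branch is a limit of points of the fibre, which is closed.
    choose y hy hyx using fun n => (c x n).2
    have hlim : Tendsto y atTop (𝓝 (h x)) := by
      rw [tendsto_pi_nhds]
      intro i
      refine tendsto_const_nhds.congr' ?_
      filter_upwards [eventually_gt_atTop i] with n hn
      exact (hmem x n (y n) (hy n) i hn).symm
    refine tendsto_nhds_unique ((hp.tendsto _).comp hlim) ?_
    simp [Function.comp_def, hyx]

/-- The Jankov–von Neumann uniformization theorem for Borel sets with full projection. -/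
theorem exists_universallyMeasurable_selection {α β : Type*} [TopologicalSpace α]
    [PolishSpace α] [MeasurableSpace α] [BorelSpace α] [TopologicalSpace β] [PolishSpace β]
    [MeasurableSpace β] [BorelSpace β] {A : Set (α × β)} (hA : MeasurableSet A)
    (hfull : ∀ x, ∃ y, (x, y) ∈ A) :
    ∃ s : α → β, UniversallyMeasurable s ∧ ∀ x, (x, s x) ∈ A := by
  rcases isEmpty_or_nonempty α with hα | ⟨⟨x₀⟩⟩
  · exact ⟨isEmptyElim, (measurable_of_empty _).universallyMeasurable, isEmptyElim⟩
  have hAn := hA.analyticSet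
  rw [AnalyticSet] at hAn
  obtain ⟨y₀, hy₀⟩ := hfull x₀
  obtain ⟨φ, hφ, rfl⟩ := hAn.resolve_left (nonempty_of_mem hy₀).ne_empty
  obtain ⟨h, hh, hhx⟩ := exists_universallyMeasurable_rightInverse
    (p := fun z => (φ z).1) (continuous_fst.comp hφ) fun x => by
      obtain ⟨y, z, hz⟩ := hfull x
      exact ⟨z, by simp [hz]⟩
  refine ⟨fun x => (φ (h x)).2, (continuous_snd.comp hφ).measurable.comp hh, fun x => ?_⟩
  exact ⟨h x, Prod.ext (hhx x) rfl⟩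

end Analytic

/-! ### Universally measurable functions and transitions -/

namespace TestingMechanism

variable {α β γ δ : Type*} [MeasurableSpace α] [MeasurableSpace β] [MeasurableSpace γ]
  [MeasurableSpace δ]

theorem UniversallyMeasurable.aemeasurable [MeasurableSpace.CountablyGenerated β] {f : α → β}
    (hf : UniversallyMeasurable f) (μ : Measure α) [IsProbabilityMeasure μ] : AEMeasurable f μ := by
  have : Nonempty β := (nonempty_of_isProbabilityMeasure μ).map f
  exact (universallyMeasurable_iff.1 hf μ inferInstance).aemeasurable

theorem UniversallyMeasurable.comp [MeasurableSpace.CountablyGenerated β] {g : β → γ} {f : α → β}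
    (hg : UniversallyMeasurable g) (hf : UniversallyMeasurable f) :
    UniversallyMeasurable fun a => g (f a) := by
  intro s hs μ hμ
  have hfm := hf.aemeasurable μ
  have := Measure.isProbabilityMeasure_map (μ := μ) hfm
  have h := hg hs (μ.map f) this
  rw [Measure.map_congr hfm.ae_eq_mk] at h
  refine (h.preimage (hfm.measurable_mk.quasiMeasurePreserving μ)).congr ?_
  filter_upwards [hfm.ae_eq_mk] with a ha
  exact congrArg (fun b => g b ∈ s) ha.symm

theorem _root_.Measurable.comp_universallyMeasurable {g : β → γ} {f : α → β}
    (hg : Measurable g) (hf : UniversallyMeasurable f) : UniversallyMeasurable fun a => g (f a) :=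
  Measurable.comp hg hf

theorem UniversallyMeasurable.prodMk {f : α → β} {g : α → γ} (hf : UniversallyMeasurable f)
    (hg : UniversallyMeasurable g) : UniversallyMeasurable fun a => (f a, g a) :=
  @Measurable.prodMk _ (universalCompletion α) _ _ _ _ _ _ hf hg

namespace Transition

theorem eq_of_toFun_eq {k l : Transition α β} (h : ∀ a, k a = l a) : k = l :=
  Transition.ext (funext h)

/-- The transition that moves `a` to `f a` with certainty. -/
noncomputable def deterministic (f : α → β) (hf : UniversallyMeasurable f) : Transition α β where
  toFun a := Measure.dirac (f a)
  isProb' _ := inferInstance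
  univMeas' _ hB := ((Measure.measurable_coe hB).comp Measure.measurable_dirac)
    |>.comp_universallyMeasurable hf

/-- The image of a transition under a measurable map. -/
noncomputable def map (k : Transition α β) (f : β → γ) (hf : Measurable f) : Transition α γ where
  toFun a := (k a).map f
  isProb' _ := Measure.isProbabilityMeasure_map hf.aemeasurable
  univMeas' B hB := by
    simp_rw [Measure.map_apply hf hB]
    exact k.univMeas' _ (hf hB)

/-- A transition, as a kernel that is measurable for the universal completion on its source. -/
noncomputable def toKernel (k : Transition α β) : @Kernel α β (universalCompletion α) _ :=
  @Kernel.mk α β (universalCompletion α) _ k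
    (@Measure.measurable_of_measurable_coe _ _ _ (universalCompletion α) _
      fun B hB => k.univMeas' B hB)

theorem lintegral_comp [MeasurableSpace.CountablyGenerated β]
    [MeasurableSpace.CountablyGenerated γ] (k : Transition α β) (l : Transition β γ) (a : α)
    {F : γ → ℝ≥0∞} (hF : UniversallyMeasurable F) :
    ∫⁻ c, F c ∂(k.comp l a) = ∫⁻ b, ∫⁻ c, F c ∂(l b) ∂(k a) :=
  Measure.lintegral_bind (l.aemeasurable _) (hF.aemeasurable (k.comp l a))

theorem lintegral_prod [MeasurableSpace.CountablyGenerated β]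
    [MeasurableSpace.CountablyGenerated γ] (k : Transition α β) (l : Transition (α × β) γ) (a : α)
    {F : β × γ → ℝ≥0∞} (hF : UniversallyMeasurable F) :
    ∫⁻ p, F p ∂(k.prod l a) = ∫⁻ b, ∫⁻ c, F (b, c) ∂(l (a, b)) ∂(k a) := by
  refine (Measure.lintegral_bind (l.aemeasurable_map_prodMk a _)
    (hF.aemeasurable (k.prod l a))).trans (lintegral_congr fun b => ?_)
  have := Measure.isProbabilityMeasure_map (μ := l (a, b)) (f := Prod.mk b)
    measurable_prodMk_left.aemeasurable
  exact lintegral_map' (hF.aemeasurable _) measurable_prodMk_left.aemeasurable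

theorem lintegral_deterministic [MeasurableSingletonClass β] {f : α → β}
    (hf : UniversallyMeasurable f) (a : α) (F : β → ℝ≥0∞) :
    ∫⁻ b, F b ∂(deterministic f hf a) = F (f a) :=
  lintegral_dirac _ _

theorem lintegral_map (k : Transition α β) {f : β → γ} (hf : Measurable f) (a : α)
    {F : γ → ℝ≥0∞} (hF : UniversallyMeasurable F) :
    ∫⁻ c, F c ∂(k.map f hf a) = ∫⁻ b, F (f b) ∂(k a) := by
  have := Measure.isProbabilityMeasure_map (μ := k a) hf.aemeasurable
  exact lintegral_map' (hF.aemeasurable _) hf.aemeasurable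

theorem borel_prod_le_universalCompletion :
    @Prod.instMeasurableSpace α β (universalCompletion α) _ ≤ universalCompletion (α × β) := by
  refine sup_le ?_ ?_
  · rintro _ ⟨s, hs, rfl⟩ μ hμ
    have := Measure.isProbabilityMeasure_map (μ := μ) (f := Prod.fst) measurable_fst.aemeasurable
    exact (hs _ this).preimage (measurable_fst.quasiMeasurePreserving μ)
  · rintro _ ⟨s, hs, rfl⟩ μ hμ
    exact (measurable_snd hs).nullMeasurableSet

theorem _root_.ProbabilityTheory.Kernel.exists_apply_eq_lintegral
    [MeasurableSpace.CountablyGenerated β] [StandardBorelSpace γ] [Nonempty γ]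
    (κ : Kernel α (β × γ)) [IsMarkovKernel κ] :
    ∃ c : Kernel (α × β) γ, IsMarkovKernel c ∧ ∀ a, ∀ D : Set (β × γ), MeasurableSet D →
      κ a D = ∫⁻ b, c (a, b) (Prod.mk b ⁻¹' D) ∂((κ a).map Prod.fst) := by
  refine ⟨κ.condKernel, inferInstance, fun a D hD => ?_⟩
  conv_lhs => rw [← Kernel.disintegrate κ κ.condKernel, Kernel.compProd_apply hD, Kernel.fst_apply]

/-- Disintegration: a transition into a product factors through its first marginal. -/
theorem exists_eq_prod [MeasurableSpace.CountablyGenerated β] [StandardBorelSpace γ] [Nonempty γ]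
    (k : Transition α (β × γ)) :
    ∃ l : Transition (α × β) γ, k = (k.map Prod.fst measurable_fst).prod l := by
  obtain ⟨c, hc, hkc⟩ := @Kernel.exists_apply_eq_lintegral α β γ (universalCompletion α) _ _ _ _ _
    k.toKernel (@IsMarkovKernel.mk _ _ (universalCompletion α) _ _ fun a => k.isProb' a)
  refine ⟨⟨c, fun p => hc.isProbabilityMeasure p, fun B hB => ?_⟩, eq_of_toFun_eq fun a => ?_⟩
  · exact (@Kernel.measurable_coe _ _ (_) _ c B hB).mono borel_prod_le_universalCompletion le_rfl
  · ext D hD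
    rw [prod_apply _ _ _ hD]
    exact hkc a D hD

end Transition

end TestingMechanism

/-! ### Score lotteries and discernment -/

namespace TestingMechanism

/-- The value `p a + (1 - p) b` of a lottery that pays `a` with probability `p`, else `b`. -/
noncomputable def lottery (p : unitInterval) (a b : ℝ≥0∞) : ℝ≥0∞ :=
  ENNReal.ofReal p * a + ENNReal.ofReal (1 - p) * b

theorem measurable_lottery :
    Measurable fun x : unitInterval × ℝ≥0∞ × ℝ≥0∞ => lottery x.1 x.2.1 x.2.2 := by
  unfold lottery
  have : Measurable fun x : unitInterval × ℝ≥0∞ × ℝ≥0∞ => (x.1 : ℝ) :=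
    measurable_subtype_coe.comp measurable_fst
  fun_prop

theorem UniversallyMeasurable.lottery {α : Type*} [MeasurableSpace α] {p : α → unitInterval}
    {a b : α → ℝ≥0∞} (hp : UniversallyMeasurable p) (ha : UniversallyMeasurable a)
    (hb : UniversallyMeasurable b) :
    UniversallyMeasurable fun x => TestingMechanism.lottery (p x) (a x) (b x) := by
  have h : UniversallyMeasurable fun x => (p x, a x, b x) := hp.prodMk (ha.prodMk hb)
  have h' := measurable_lottery.comp_universallyMeasurable h
  exact h'

theorem lintegral_scoreLaw (p : unitInterval) (F : Bool → ℝ≥0∞) :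
    ∫⁻ b, F b ∂(scoreLaw p) = lottery p (F true) (F false) := by
  have h : scoreLaw p = unitInterval.toNNReal p • Measure.dirac true
        + unitInterval.toNNReal (unitInterval.symm p) • Measure.dirac false := rfl
  have h1 : ENNReal.ofReal p = unitInterval.toNNReal p := ENNReal.ofReal_eq_coe_nnreal p.2.1
  have h2 : ENNReal.ofReal (1 - p) = unitInterval.toNNReal (unitInterval.symm p) :=
    ENNReal.ofReal_eq_coe_nnreal (unitInterval.symm p).2.1
  rw [h, lintegral_add_measure, lintegral_smul_measure, lintegral_smul_measure, lintegral_dirac,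
    lintegral_dirac, lottery, h1, h2]
  rfl

/-- The convex combination `p a + (1 - p) b` in the unit interval. -/
noncomputable def mix (p a b : unitInterval) : unitInterval :=
  ⟨p * a + (1 - p) * b, convex_Icc (0 : ℝ) 1 a.2 b.2 p.2.1 (sub_nonneg.2 p.2.2) (by ring)⟩

theorem coe_mix (p a b : unitInterval) : (mix p a b : ℝ) = p * a + (1 - p) * b := rfl

theorem measurable_mix :
    Measurable fun x : unitInterval × unitInterval × unitInterval => mix x.1 x.2.1 x.2.2 :=
  Continuous.measurable <| Continuous.subtype_mk (by fun_prop) _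

theorem UniversallyMeasurable.mix {α : Type*} [MeasurableSpace α] {p a b : α → unitInterval}
    (hp : UniversallyMeasurable p) (ha : UniversallyMeasurable a) (hb : UniversallyMeasurable b) :
    UniversallyMeasurable fun x => TestingMechanism.mix (p x) (a x) (b x) :=
  measurable_mix.comp_universallyMeasurable (hp.prodMk (ha.prodMk hb))

theorem UniversallyMeasurable.mul {α : Type*} [MeasurableSpace α] {a b : α → unitInterval}
    (ha : UniversallyMeasurable a) (hb : UniversallyMeasurable b) :
    UniversallyMeasurable fun x => a x * b x :=
  @Measurable.mul _ _ _ _ (universalCompletion _) _ _ _ ha hb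

theorem lottery_lottery (p q q' : unitInterval) (a b : ℝ≥0∞) :
    lottery p (lottery q a b) (lottery q' a b) = lottery (mix p q q') a b := by
  have hp := p.2; have hq := q.2; have hq' := q'.2
  have hp' := sub_nonneg.2 hp.2
  have h1 : ENNReal.ofReal (mix p q q') = ENNReal.ofReal p * ENNReal.ofReal q
      + ENNReal.ofReal (1 - p) * ENNReal.ofReal q' := by
    rw [coe_mix, ENNReal.ofReal_add (mul_nonneg hp.1 hq.1) (mul_nonneg hp' hq'.1),
      ENNReal.ofReal_mul hp.1, ENNReal.ofReal_mul hp']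
  have h2 : ENNReal.ofReal (1 - mix p q q') = ENNReal.ofReal p * ENNReal.ofReal (1 - q)
      + ENNReal.ofReal (1 - p) * ENNReal.ofReal (1 - q') := by
    rw [← ENNReal.ofReal_mul hp.1, ← ENNReal.ofReal_mul hp',
      ← ENNReal.ofReal_add (mul_nonneg hp.1 (sub_nonneg.2 hq.2))
        (mul_nonneg hp' (sub_nonneg.2 hq'.2)), coe_mix]
    ring_nf
  simp only [lottery, h1, h2]
  ring

theorem scoreLaw_true (p : unitInterval) : scoreLaw p {true} = ENNReal.ofReal p := by
  rw [← lintegral_indicator_one (measurableSet_singleton _), lintegral_scoreLaw]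
  simp [lottery]

theorem scoreLaw_false (p : unitInterval) : scoreLaw p {false} = ENNReal.ofReal (1 - p) := by
  rw [← lintegral_indicator_one (measurableSet_singleton _), lintegral_scoreLaw]
  simp [lottery]

theorem exists_eq_scoreLaw (μ : Measure Bool) [IsProbabilityMeasure μ] :
    ∃ p : unitInterval, μ = scoreLaw p := by
  have ht : ENNReal.ofReal (μ.real {true}) = μ {true} := ofReal_measureReal
  refine ⟨⟨μ.real {true}, measureReal_nonneg, measureReal_le_one⟩, ?_⟩
  have hc : μ {false} = 1 - μ {true} := by
    rw [← prob_compl_eq_one_sub (measurableSet_singleton _)]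
    congr 1; ext b; cases b <;> simp
  refine Measure.ext_of_singleton fun b => ?_
  cases b
  · rw [scoreLaw_false, hc, ENNReal.ofReal_sub _ measureReal_nonneg, ht, ENNReal.ofReal_one]
  · rw [scoreLaw_true, ht]

theorem scoreLaw_bind (p a b : unitInterval) (k : Kernel Bool Bool) (ht : k true = scoreLaw a)
    (hf : k false = scoreLaw b) : (scoreLaw p).bind k = scoreLaw (mix p a b) := by
  refine Measure.ext_of_singleton fun s => ?_
  rw [Measure.bind_apply (measurableSet_singleton _) k.aemeasurable, lintegral_scoreLaw, ht, hf,
    ← lintegral_indicator_one (measurableSet_singleton _),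
    ← lintegral_indicator_one (measurableSet_singleton _),
    ← lintegral_indicator_one (measurableSet_singleton _), lintegral_scoreLaw, lintegral_scoreLaw,
    lintegral_scoreLaw, lottery_lottery]

theorem stochDominates_scoreLaw {p q : unitInterval} :
    StochDominates (scoreLaw p) (scoreLaw q) → q ≤ p := by
  intro h
  have h := h false
  have hI : Iic false = {false} := by ext b; cases b <;> simp
  rw [hI, scoreLaw_false, scoreLaw_false,
    ENNReal.ofReal_le_ofReal_iff (sub_nonneg.2 q.2.2)] at h
  exact Subtype.coe_le_coe.1 (by linarith)

theorem scoreLaw_injective : Function.Injective scoreLaw := fun p q h => by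
  have := congrArg (fun μ => μ {true}) h
  simp only [scoreLaw_true] at this
  exact Subtype.ext ((ENNReal.ofReal_eq_ofReal_iff p.2.1 q.2.1).1 this)

variable {Θ T : Type*} [MeasurableSpace Θ] [MeasurableSpace T]

/-- The comparison `τ ⪰_θ ψ` in terms of the probabilities `a ≥ b` with which the score conversion
turns a pass and a fail on `τ` into a pass on `ψ`. -/
theorem MoreDiscerning.exists_mix {π : PassageRate Θ T} {θ : Θ} {τ ψ : T}
    (h : MoreDiscerning π θ τ ψ) :
    ∃ a b : unitInterval, b ≤ a ∧ mix (π.passage (τ, θ)) a b = π.passage (ψ, θ) ∧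
      ∀ θ', mix (π.passage (τ, θ')) a b ≤ π.passage (ψ, θ') := by
  obtain ⟨k, hk, hmono, heq, hle⟩ := h
  obtain ⟨a, ha⟩ := exists_eq_scoreLaw (k true)
  obtain ⟨b, hb⟩ := exists_eq_scoreLaw (k false)
  have hbind := fun p => scoreLaw_bind p a b k ha hb
  have heq' : mix (π.passage (τ, θ)) a b = π.passage (ψ, θ) := by
    rw [hbind] at heq
    exact scoreLaw_injective heq
  refine ⟨a, b, ?_, heq', fun θ' => ?_⟩
  · have := hmono true false (by decide)
    rw [ha, hb] at this
    exact stochDominates_scoreLaw this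
  · rcases eq_or_ne θ' θ with rfl | hne
    · exact heq'.le
    · have := hle θ' hne
      rw [hbind] at this
      exact stochDominates_scoreLaw this

/-- A universally measurable choice of a more discerning test from a most-discerning
correspondence, together with the probabilities of the corresponding score conversion. -/
theorem MostDiscerning.exists_selection [TopologicalSpace Θ] [PolishSpace Θ] [BorelSpace Θ]
    [TopologicalSpace T] [PolishSpace T] [BorelSpace T] {π : PassageRate Θ T}
    (hπ : Continuous π.passage) {That : Θ → Set T}
    (hgraph : MeasurableSet {p : Θ × T | p.2 ∈ That p.1}) (h : MostDiscerning π That) :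
    ∃ (s : Θ × T → T) (a b : Θ × T → unitInterval), UniversallyMeasurable s ∧
      UniversallyMeasurable a ∧ UniversallyMeasurable b ∧ ∀ θ ψ, s (θ, ψ) ∈ That θ ∧
        b (θ, ψ) ≤ a (θ, ψ) ∧
        mix (π.passage (s (θ, ψ), θ)) (a (θ, ψ)) (b (θ, ψ)) = π.passage (ψ, θ) ∧
        ∀ θ', mix (π.passage (s (θ, ψ), θ')) (a (θ, ψ)) (b (θ, ψ)) ≤ π.passage (ψ, θ') := by
  obtain ⟨D, hD, hdense⟩ := TopologicalSpace.exists_countable_dense Θ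
  have hm := π.measurable_passage
  let E := (Θ × T) × (T × unitInterval × unitInterval)
  have hmix : ∀ {q : E → T × Θ}, Measurable q →
      Measurable fun x : E => mix (π.passage (q x)) x.2.2.1 x.2.2.2 := fun hq =>
    measurable_mix.comp ((hm.comp hq).prodMk (by fun_prop))
  let A : Set E := {x | x.2.1 ∈ That x.1.1 ∧ x.2.2.2 ≤ x.2.2.1 ∧
    mix (π.passage (x.2.1, x.1.1)) x.2.2.1 x.2.2.2 = π.passage (x.1.2, x.1.1) ∧
    ∀ d ∈ D, mix (π.passage (x.2.1, d)) x.2.2.1 x.2.2.2 ≤ π.passage (x.1.2, d)}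
  have hA : MeasurableSet A := by
    have h1 : MeasurableSet {x : E | x.2.1 ∈ That x.1.1} :=
      (measurable_fst.fst.prodMk measurable_snd.fst) hgraph
    have h2 : MeasurableSet {x : E | x.2.2.2 ≤ x.2.2.1} :=
      measurableSet_le (by fun_prop) (by fun_prop)
    have h3 : MeasurableSet {x : E | mix (π.passage (x.2.1, x.1.1)) x.2.2.1 x.2.2.2 =
        π.passage (x.1.2, x.1.1)} :=
      measurableSet_eq_fun (hmix (by fun_prop)) (by fun_prop)
    have h4 : MeasurableSet (⋂ d ∈ D, {x : E |
        mix (π.passage (x.2.1, d)) x.2.2.1 x.2.2.2 ≤ π.passage (x.1.2, d)}) :=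
      .biInter hD fun d _ => measurableSet_le (hmix (by fun_prop)) (by fun_prop)
    convert h1.inter (h2.inter (h3.inter h4)) using 1
    ext x
    simp [A]
  obtain ⟨S, hS, hSA⟩ := exists_universallyMeasurable_selection hA fun x => by
    obtain ⟨τ, hτ, hτx⟩ := h x.1 x.2
    obtain ⟨a, b, hba, heq, hle⟩ := hτx.exists_mix
    exact ⟨(τ, a, b), hτ, hba, heq, fun d _ => hle d⟩
  refine ⟨fun x => (S x).1, fun x => (S x).2.1, fun x => (S x).2.2,
    measurable_fst.comp_universallyMeasurable hS,
    measurable_snd.fst.comp_universallyMeasurable hS,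
    measurable_snd.snd.comp_universallyMeasurable hS, fun θ ψ => ?_⟩
  obtain ⟨hmem, hba, heq, hle⟩ := hSA (θ, ψ)
  refine ⟨hmem, hba, heq, fun θ' => ?_⟩
  -- By continuity of the passage rate the inequality extends from the dense set to all types.
  have hclosed : IsClosed {t | mix (π.passage ((S (θ, ψ)).1, t)) (S (θ, ψ)).2.1 (S (θ, ψ)).2.2
      ≤ π.passage (ψ, t)} := by
    refine isClosed_le (Continuous.subtype_mk ?_ _) (by fun_prop)
    fun_prop
  exact hclosed.closure_subset_iff.2 hle (hdense θ')

end TestingMechanism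

/-! ### Averaging out a private signal -/

namespace TestingMechanism

/-- A weight `h` that depends on a pair and is bounded by a function `a` of the second coordinate
can be replaced, inside integrals of functions of the second coordinate, by `e * a` with `e ≤ 1`:
`e * a` is the conditional expectation of `h` given the second coordinate. -/
theorem exists_lintegral_mul_eq {Γ Ω : Type*} [MeasurableSpace Γ] [MeasurableSpace Ω]
    (Q : Measure (Γ × Ω)) [IsFiniteMeasure Q] {h : Γ × Ω → ℝ≥0∞} (hh : AEMeasurable h Q)
    {a : Ω → ℝ≥0∞} (ha : Measurable a) (ha1 : ∀ ω, a ω ≤ 1) (hle : ∀ q, h q ≤ a q.2) :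
    ∃ e : Ω → ℝ≥0∞, Measurable e ∧ (∀ ω, e ω ≤ 1) ∧
      ∀ G : Ω → ℝ≥0∞, AEMeasurable G Q.snd →
        ∫⁻ q, h q * G q.2 ∂Q = ∫⁻ ω, e ω * a ω * G ω ∂Q.snd := by
  let κ := (Q.withDensity h).snd
  let ν := Q.snd.withDensity a
  have hν : IsFiniteMeasure ν := isFiniteMeasure_withDensity <| ne_of_lt <|
    (lintegral_mono ha1).trans_lt (by simp)
  have hκν : κ ≤ ν := by
    refine Measure.le_iff.2 fun D hD => ?_
    rw [Measure.snd_apply hD, withDensity_apply _ (measurable_snd hD), withDensity_apply _ hD,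
      Measure.snd, setLIntegral_map hD ha measurable_snd]
    exact lintegral_mono fun q => hle q
  have hκ : IsFiniteMeasure κ := isFiniteMeasure_of_le ν hκν
  have hκac : κ ≪ Q.snd := hκν.absolutelyContinuous.trans (withDensity_absolutelyContinuous _ _)
  refine ⟨fun ω => min (κ.rnDeriv ν ω) 1, by fun_prop, fun ω => min_le_right _ _, fun G hG => ?_⟩
  have he : ν.withDensity (fun ω => min (κ.rnDeriv ν ω) 1) = κ := by
    conv_rhs => rw [← Measure.withDensity_rnDeriv_eq κ ν hκν.absolutelyContinuous]
    refine withDensity_congr_ae ?_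
    filter_upwards [Measure.rnDeriv_le_one_of_le hκν] with ω hω
    exact min_eq_left hω
  have hG2 : AEMeasurable (fun q : Γ × Ω => G q.2) Q := hG.comp_measurable measurable_snd
  calc ∫⁻ q, h q * G q.2 ∂Q = ∫⁻ q, G q.2 ∂(Q.withDensity h) :=
        (lintegral_withDensity_eq_lintegral_mul₀ hh hG2).symm
    _ = ∫⁻ ω, G ω ∂κ := (lintegral_map' (hG.mono_ac hκac) measurable_snd.aemeasurable).symm
    _ = ∫⁻ ω, min (κ.rnDeriv ν ω) 1 * G ω ∂ν := by
        conv_lhs => rw [← he]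
        exact lintegral_withDensity_eq_lintegral_mul₀ (by fun_prop)
          (hG.mono_ac (withDensity_absolutelyContinuous _ _))
    _ = ∫⁻ ω, a ω * (min (κ.rnDeriv ν ω) 1 * G ω) ∂Q.snd :=
        lintegral_withDensity_eq_lintegral_mul₀ ha.aemeasurable
          (.mul (by fun_prop) hG)
    _ = _ := lintegral_congr fun ω => by ring

/-- Averaging the passage probability `P` over the first coordinate of a pair, given the second,
does not change the expected outcome; if `P` is bounded by `a`, so is the average, which is
therefore `e * a` for some effort `e`. -/
theorem exists_lintegral_lottery_eq {Γ Ω : Type*} [MeasurableSpace Γ] [MeasurableSpace Ω]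
    (Q : Measure (Γ × Ω)) [IsProbabilityMeasure Q] {P : Γ × Ω → unitInterval}
    (hP : AEMeasurable P Q) {a : Ω → unitInterval} (ha : Measurable a)
    (hle : ∀ q, P q ≤ a q.2) :
    ∃ e : Ω → unitInterval, Measurable e ∧
      ∀ G₁ G₀ : Ω → ℝ≥0∞, AEMeasurable G₁ Q.snd → AEMeasurable G₀ Q.snd → (∀ ω, G₀ ω ≤ 1) →
        ∫⁻ q, lottery (P q) (G₁ q.2) (G₀ q.2) ∂Q
          = ∫⁻ ω, lottery (e ω * a ω) (G₁ ω) (G₀ ω) ∂Q.snd := by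
  have hPm : AEMeasurable (fun q => ENNReal.ofReal (P q)) Q :=
    (measurable_subtype_coe.comp_aemeasurable hP).ennreal_ofReal
  have ham : Measurable fun ω => ENNReal.ofReal (a ω) :=
    (measurable_subtype_coe.comp ha).ennreal_ofReal
  obtain ⟨e, he, he1, hint⟩ := exists_lintegral_mul_eq Q hPm ham
    (fun ω => ENNReal.ofReal_le_one.2 (a ω).2.2) fun q => ENNReal.ofReal_le_ofReal (hle q)
  let e' : Ω → unitInterval := fun ω =>
    ⟨(e ω).toReal, ENNReal.toReal_nonneg, ENNReal.toReal_le_of_le_ofReal zero_le_one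
      (by simpa using he1 ω)⟩
  have he' : Measurable e' := he.ennreal_toReal.subtype_mk
  have hea : ∀ ω, ENNReal.ofReal (e' ω * a ω : unitInterval) = e ω * ENNReal.ofReal (a ω) := by
    intro ω
    have : ((e' ω * a ω : unitInterval) : ℝ) = (e ω).toReal * a ω := rfl
    rw [this, ENNReal.ofReal_mul ENNReal.toReal_nonneg,
      ENNReal.ofReal_toReal ((he1 ω).trans_lt ENNReal.one_lt_top).ne]
  have hsum : ∀ (p : unitInterval) (x : ℝ≥0∞),
      ENNReal.ofReal p * x + ENNReal.ofReal (1 - p) * x = x := by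
    intro p x
    rw [← add_mul, ← ENNReal.ofReal_add p.2.1 (sub_nonneg.2 p.2.2)]
    simp
  refine ⟨e', he', fun G₁ G₀ h₁ h₀ hG₀ => ?_⟩
  have hpass : ∀ G : Ω → ℝ≥0∞, AEMeasurable G Q.snd →
      ∫⁻ q, ENNReal.ofReal (P q) * G q.2 ∂Q
        = ∫⁻ ω, ENNReal.ofReal (e' ω * a ω : unitInterval) * G ω ∂Q.snd := fun G hG => by
    simp_rw [hea]
    exact hint G hG
  have heam : Measurable fun ω => ENNReal.ofReal (e' ω * a ω : unitInterval) :=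
    (measurable_subtype_coe.comp (he'.mul ha)).ennreal_ofReal
  have hl : ∀ (G : Ω → ℝ≥0∞) (K : Γ × Ω → ℝ≥0∞), AEMeasurable G Q.snd →
      ∫⁻ q, ENNReal.ofReal (P q) * G q.2 + K q ∂Q
        = ∫⁻ q, ENNReal.ofReal (P q) * G q.2 ∂Q + ∫⁻ q, K q ∂Q := fun G K hG =>
    lintegral_add_left' (hPm.mul (hG.comp_measurable measurable_snd)) K
  have hr : ∀ G K : Ω → ℝ≥0∞, AEMeasurable G Q.snd →
      ∫⁻ ω, ENNReal.ofReal (e' ω * a ω : unitInterval) * G ω + K ω ∂Q.snd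
        = ∫⁻ ω, ENNReal.ofReal (e' ω * a ω : unitInterval) * G ω ∂Q.snd + ∫⁻ ω, K ω ∂Q.snd :=
    fun G K hG => lintegral_add_left' (heam.aemeasurable.mul hG) K
  -- Adding the finite passing part for `G₀` turns both sides into the integral of `G₀`.
  have hfail : ∫⁻ q, ENNReal.ofReal (1 - P q) * G₀ q.2 ∂Q
      = ∫⁻ ω, ENNReal.ofReal (1 - (e' ω * a ω : unitInterval)) * G₀ ω ∂Q.snd := by
    have hfin : ∫⁻ q, ENNReal.ofReal (P q) * G₀ q.2 ∂Q ≠ ⊤ := by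
      refine ne_of_lt (lt_of_le_of_lt (lintegral_mono (g := fun _ => 1) fun q => ?_) (by simp))
      exact mul_le_one' (ENNReal.ofReal_le_one.2 (P q).2.2) (hG₀ _)
    refine (ENNReal.add_right_inj hfin).1 ?_
    conv_rhs => rw [hpass G₀ h₀]
    rw [← hl _ _ h₀, ← hr _ _ h₀]
    simp_rw [hsum]
    exact (lintegral_map' h₀ measurable_snd.aemeasurable).symm
  unfold lottery
  rw [hl _ _ h₁, hr _ _ h₁, hpass G₁ h₁, hfail]

end TestingMechanism

/-! ### The direct mechanism -/

namespace TestingMechanism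

section Transitions

variable {α : Type*} [MeasurableSpace α]

theorem UniversallyMeasurable.cond {c : α → Bool} {p q : α → unitInterval}
    (hc : UniversallyMeasurable c) (hp : UniversallyMeasurable p) (hq : UniversallyMeasurable q) :
    UniversallyMeasurable fun x => bif c x then p x else q x := by
  have h : Measurable fun x : Bool × unitInterval × unitInterval =>
      bif x.1 then x.2.1 else x.2.2 := by
    refine measurable_from_prod_countable_right fun c => ?_
    cases c
    · exact measurable_snd
    · exact measurable_fst
  exact h.comp_universallyMeasurable (hc.prodMk (hp.prodMk hq))

/-- The transition that draws a pass with a probability that depends on the source point. -/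
noncomputable def scoreTransition (p : α → unitInterval) (hp : UniversallyMeasurable p) :
    Transition α Bool where
  toFun x := scoreLaw (p x)
  isProb' _ := inferInstance
  univMeas' B _ := (measurable_scoreLaw_apply B).comp_universallyMeasurable hp

theorem lottery_lintegral (μ : Measure α) {F₁ : α → ℝ≥0∞} (h₁ : AEMeasurable F₁ μ)
    (F₀ : α → ℝ≥0∞) (p : unitInterval) :
    lottery p (∫⁻ x, F₁ x ∂μ) (∫⁻ x, F₀ x ∂μ) = ∫⁻ x, lottery p (F₁ x) (F₀ x) ∂μ := by
  unfold lottery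
  rw [lintegral_add_left' (h₁.const_mul _), lintegral_const_mul' _ _ ENNReal.ofReal_ne_top,
    lintegral_const_mul' _ _ ENNReal.ofReal_ne_top]

end Transitions

variable {Θ T X M : Type*} [MeasurableSpace Θ] [MeasurableSpace T] [MeasurableSpace X]
  [MeasurableSpace M]

theorem Mechanism.universallyMeasurable_decision (mech : Mechanism T X M) (c : Bool) {B : Set X}
    (hB : MeasurableSet B) :
    UniversallyMeasurable fun ω : M × T => mech.decision (ω.1, ω.2, c) B :=
  (mech.decision.univMeas' B hB).comp_measurable (f := fun ω : M × T => (ω.1, ω.2, c))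
    (by fun_prop)

/-- The probability with which the direct mechanism treats type `θ'` as having passed the original
test `ω.2` after the original message `ω.1`, when the report is `θ`, the test `τ` is
administered in place of `ω.2`, and effort on it is chosen according to `σ'`: the score is converted
with the probabilities `a` and `b`, and a converted pass is upheld with the probability with which
type `θ` exerts effort under `σ`. -/
noncomputable def passProb (π : PassageRate Θ T) (σ : Strategy Θ T M) (a b : Θ × T → unitInterval)
    (σ' : Strategy Θ T Θ) (θ' θ : Θ) (τ : T) (ω : M × T) : unitInterval :=
  mix (σ'.effort (θ', θ, τ) * π.passage (τ, θ')) (σ.effort (θ, ω) * a (θ, ω.2))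
    (σ.effort (θ, ω) * b (θ, ω.2))

theorem universallyMeasurable_passProb (π : PassageRate Θ T) (σ : Strategy Θ T M)
    {a b : Θ × T → unitInterval} (ha : UniversallyMeasurable a) (hb : UniversallyMeasurable b)
    (σ' : Strategy Θ T Θ) (θ' : Θ) :
    UniversallyMeasurable fun x : Θ × T × (M × T) => passProb π σ a b σ' θ' x.1 x.2.1 x.2.2 := by
  have he : UniversallyMeasurable fun x : Θ × T × (M × T) => σ.effort (x.1, x.2.2) :=
    σ.univMeas_effort.comp_measurable (f := fun x : Θ × T × (M × T) => (x.1, x.2.2)) (by fun_prop)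
  have he' : UniversallyMeasurable fun x : Θ × T × (M × T) => σ'.effort (θ', x.1, x.2.1) :=
    σ'.univMeas_effort.comp_measurable (f := fun x : Θ × T × (M × T) => (θ', x.1, x.2.1))
      (by fun_prop)
  have hπ : UniversallyMeasurable fun x : Θ × T × (M × T) => π.passage (x.2.1, θ') :=
    (π.measurable_passage.comp (by fun_prop)).universallyMeasurable
  have hm : Measurable fun x : Θ × T × (M × T) => (x.1, x.2.2.2) := by fun_prop
  exact (he'.mul hπ).mix (he.mul (ha.comp_measurable hm)) (he.mul (hb.comp_measurable hm))

section

variable [MeasurableSpace.CountablyGenerated T] [MeasurableSpace.CountablyGenerated X]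
  [MeasurableSpace.CountablyGenerated M]

/-- The joint law of the message and the test, given the type. -/
noncomputable def messageTest (mech : Mechanism T X M) (σ : Strategy Θ T M) :
    Transition Θ (M × T) :=
  σ.report.prod (mech.testing.comap Prod.snd measurable_snd)

theorem induced_apply (π : PassageRate Θ T) (mech : Mechanism T X M) (σ : Strategy Θ T M) (θ : Θ)
    {B : Set X} (hB : MeasurableSet B) :
    induced π mech σ θ B = ∫⁻ ω, lottery (σ.effort (θ, ω) * π.passage (ω.2, θ))
      (mech.decision (ω.1, ω.2, true) B) (mech.decision (ω.1, ω.2, false) B)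
        ∂(messageTest mech σ θ) := by
  refine (Transition.comp_apply _ _ θ hB).trans ?_
  refine (Transition.lintegral_prod _ _ θ (Transition.univMeas' _ B hB)).trans ?_
  exact lintegral_congr fun ω => lintegral_scoreLaw _ _

/-- The direct mechanism: upon the report `θ`, a message and a test `ψ` are drawn as under `σ` at
`θ`, the test `s (θ, ψ)` is administered instead of `ψ`, its score is converted, and the original
decision rule is applied. The message and `ψ` are redrawn from their conditional law given the
administered test, so that the decision depends on the report, that test and its score alone. -/
theorem exists_direct_mechanism [MeasurableSpace.CountablyGenerated Θ]
    [StandardBorelSpace T] [StandardBorelSpace M] [Nonempty (M × T)]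
    (π : PassageRate Θ T)
    (mech : Mechanism T X M) (σ : Strategy Θ T M) {s : Θ × T → T} {a b : Θ × T → unitInterval}
    (hs : UniversallyMeasurable s) (ha : UniversallyMeasurable a) (hb : UniversallyMeasurable b) :
    ∃ (t : Transition Θ T) (g : Transition (Θ × T × Bool) X),
      (∀ θ B, MeasurableSet B →
        t θ B = ∫⁻ ω, B.indicator 1 (s (θ, ω.2)) ∂(messageTest mech σ θ)) ∧
      ∀ (σ' : Strategy Θ T Θ) θ' B, MeasurableSet B → induced π ⟨t, g⟩ σ' θ' B =
        ∫⁻ θ, ∫⁻ ω, lottery (passProb π σ a b σ' θ' θ (s (θ, ω.2)) ω)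
          (mech.decision (ω.1, ω.2, true) B) (mech.decision (ω.1, ω.2, false) B)
            ∂(messageTest mech σ θ) ∂(σ'.report θ') := by
  let J := messageTest mech σ
  have hs' : UniversallyMeasurable fun x : Θ × (M × T) => s (x.1, x.2.2) :=
    hs.comp_measurable (f := fun x : Θ × (M × T) => (x.1, x.2.2)) (by fun_prop)
  let K : Transition Θ (T × (M × T)) :=
    (J.prod (.deterministic _ hs')).map Prod.swap measurable_swap
  have hK : ∀ θ (F : T × (M × T) → ℝ≥0∞), UniversallyMeasurable F →
      ∫⁻ x, F x ∂(K θ) = ∫⁻ ω, F (s (θ, ω.2), ω) ∂(J θ) := by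
    intro θ F hF
    refine (Transition.lintegral_map _ measurable_swap θ hF).trans ?_
    refine (Transition.lintegral_prod _ _ θ (hF.comp_measurable measurable_swap)).trans ?_
    exact lintegral_congr fun ω => Transition.lintegral_deterministic hs' _ _
  obtain ⟨C, hC⟩ := K.exists_eq_prod
  let t := K.map Prod.fst measurable_fst
  let q : (Θ × T × Bool) × (M × T) → unitInterval := fun x =>
    σ.effort (x.1.1, x.2) * bif x.1.2.2 then a (x.1.1, x.2.2) else b (x.1.1, x.2.2)
  have hq : UniversallyMeasurable q := by
    have he := σ.univMeas_effort.comp_measurable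
      (f := fun x : (Θ × T × Bool) × (M × T) => (x.1.1, x.2)) (by fun_prop)
    have hm : Measurable fun x : (Θ × T × Bool) × (M × T) => (x.1.1, x.2.2) := by fun_prop
    have hc : Measurable fun x : (Θ × T × Bool) × (M × T) => x.1.2.2 := by fun_prop
    exact he.mul (hc.universallyMeasurable.cond (ha.comp_measurable hm) (hb.comp_measurable hm))
  let g : Transition (Θ × T × Bool) X :=
    ((C.comap (fun x : Θ × T × Bool => (x.1, x.2.1)) (by fun_prop)).prod
      (scoreTransition q hq)).comp
        (mech.decision.comap MeasurableEquiv.prodAssoc MeasurableEquiv.prodAssoc.measurable)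
  have hg : ∀ x B, MeasurableSet B → g x B = ∫⁻ ω, lottery (q (x, ω))
      (mech.decision (ω.1, ω.2, true) B) (mech.decision (ω.1, ω.2, false) B)
        ∂(C (x.1, x.2.1)) := by
    intro x B hB
    refine (Transition.comp_apply _ _ x hB).trans ?_
    refine (Transition.lintegral_prod _ _ x (Transition.univMeas' _ B hB)).trans ?_
    exact lintegral_congr fun ω => lintegral_scoreLaw _ _
  refine ⟨t, g, fun θ B hB => ?_, fun σ' θ' B hB => ?_⟩
  · have hi : Measurable (B.indicator (1 : T → ℝ≥0∞)) := measurable_one.indicator hB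
    rw [← lintegral_indicator_one hB]
    refine (Transition.lintegral_map K measurable_fst θ hi.universallyMeasurable).trans ?_
    exact hK θ _ (hi.comp measurable_fst).universallyMeasurable
  · have h₁ := mech.universallyMeasurable_decision true hB
    have h₀ := mech.universallyMeasurable_decision false hB
    have hP := universallyMeasurable_passProb π σ ha hb σ' θ'
    rw [induced_apply π _ σ' θ' hB]
    have hF : UniversallyMeasurable fun x : Θ × T =>
        lottery (σ'.effort (θ', x) * π.passage (x.2, θ')) (g (x.1, x.2, true) B)
          (g (x.1, x.2, false) B) := by
      have he := σ'.univMeas_effort.comp_measurable (f := fun x : Θ × T => (θ', x)) (by fun_prop)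
      have hπ : Measurable fun x : Θ × T => π.passage (x.2, θ') :=
        π.measurable_passage.comp (by fun_prop)
      exact (he.mul hπ.universallyMeasurable).lottery
        ((⟨t, g⟩ : Mechanism T X Θ).universallyMeasurable_decision true hB)
        ((⟨t, g⟩ : Mechanism T X Θ).universallyMeasurable_decision false hB)
    refine (Transition.lintegral_prod _ _ θ' hF).trans (lintegral_congr fun θ => ?_)
    have hPθ : UniversallyMeasurable fun y : T × (M × T) =>
        lottery (passProb π σ a b σ' θ' θ y.1 y.2) (mech.decision (y.2.1, y.2.2, true) B)
          (mech.decision (y.2.1, y.2.2, false) B) :=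
      (hP.comp_measurable (f := fun y : T × (M × T) => (θ, y)) (by fun_prop)).lottery
        (h₁.comp_measurable measurable_snd) (h₀.comp_measurable measurable_snd)
    rw [← hK θ _ hPθ, hC]
    refine Eq.trans (lintegral_congr fun τ => ?_) (Transition.lintegral_prod t C θ hPθ).symm
    have hL : UniversallyMeasurable fun ω : M × T => lottery (q ((θ, τ, true), ω))
        (mech.decision (ω.1, ω.2, true) B) (mech.decision (ω.1, ω.2, false) B) :=
      (hq.comp_measurable (f := fun ω => ((θ, τ, true), ω)) (by fun_prop)).lottery h₁ h₀
    simp only [hg _ B hB]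
    rw [lottery_lintegral _ (hL.aemeasurable _)]
    exact lintegral_congr fun ω => lottery_lottery _ _ _ _ _

end

end TestingMechanism

/-! ### Canonical implementation -/

namespace TestingMechanism

theorem mix_mul_mul (p e a b : unitInterval) : mix p (e * a) (e * b) = e * mix p a b := by
  ext
  simp only [coe_mix, Set.Icc.coe_mul]
  ring

theorem mix_mono_left {p q a b : unitInterval} (hpq : p ≤ q) (hba : b ≤ a) :
    mix p a b ≤ mix q a b := by
  refine Subtype.coe_le_coe.1 ?_
  have hpq : (p : ℝ) ≤ q := hpq
  have hba : (b : ℝ) ≤ a := hba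
  simp only [coe_mix]
  nlinarith [mul_le_mul_of_nonneg_right hpq (sub_nonneg.2 hba)]

theorem support_subset_of_lintegral_indicator {T : Type*} [MeasurableSpace T]
    [TopologicalSpace T] [HereditarilyLindelofSpace T] [OpensMeasurableSpace T] {Ω : Type*} [MeasurableSpace Ω] {μ : Measure T} {ν : Measure Ω}
    {S : Ω → T} (h : ∀ B, MeasurableSet B → μ B = ∫⁻ ω, B.indicator 1 (S ω) ∂ν) {F : Set T}
    (hF : IsClosed F) (hS : ∀ ω, S ω ∈ F) : μ.support ⊆ F := by
  refine Measure.support_subset_of_isClosed hF (mem_ae_iff.2 ?_)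
  rw [h _ hF.measurableSet.compl]
  simp [hS]

variable {Θ T X M : Type*} [MeasurableSpace Θ] [MeasurableSpace T] [MeasurableSpace X]
  [MeasurableSpace M] [MeasurableSpace.CountablyGenerated Θ]
  [MeasurableSpace.CountablyGenerated T] [MeasurableSpace.CountablyGenerated M]

/-- Imitating a random type drawn from `r` produces messages and tests in the original mechanism
that are distributed as if the report were `r.comp σ.report`. -/
theorem snd_prod_messageTest (mech : Mechanism T X M) (σ : Strategy Θ T M)
    (r : Transition Θ Θ) (e : Θ × M × T → unitInterval) (he : UniversallyMeasurable e) (θ : Θ) :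
    (r.prod ((messageTest mech σ).comap Prod.snd measurable_snd) θ).snd
      = messageTest mech ⟨r.comp σ.report, e, he⟩ θ := by
  ext D hD
  have hF : UniversallyMeasurable fun m => mech.testing m (Prod.mk m ⁻¹' D) := by
    let k : Transition (Unit × M) T := mech.testing.comap Prod.snd measurable_snd
    have h := (k.univMeas_section hD).comp_measurable (f := fun m => ((), m)) measurable_prodMk_left
    exact h
  calc _ = ∫⁻ θ', messageTest mech σ θ' D ∂(r θ) := by
        rw [Measure.snd_apply hD]
        exact Transition.prod_apply _ _ _ (measurable_snd hD)
    _ = ∫⁻ θ', ∫⁻ m, mech.testing m (Prod.mk m ⁻¹' D) ∂(σ.report θ') ∂(r θ) :=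
        lintegral_congr fun θ' => Transition.prod_apply _ _ _ hD
    _ = ∫⁻ m, mech.testing m (Prod.mk m ⁻¹' D) ∂(r.comp σ.report θ) :=
        (Transition.lintegral_comp r σ.report θ hF).symm
    _ = _ := (Transition.prod_apply (r.comp σ.report)
        (mech.testing.comap Prod.snd measurable_snd) θ hD).symm

/-- If the probability `P` of being treated as having passed `ψ` never exceeds the passage rate on
`ψ` of type `θ`, then type `θ` can bring about the same lottery in the original mechanism: imitate
the messages of a report drawn from `r`, and exert effort with the average conditional
probability. -/
theorem exists_strategy_induced_eq [MeasurableSpace.CountablyGenerated X]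
    (π : PassageRate Θ T) (mech : Mechanism T X M) (σ : Strategy Θ T M)
    (r : Transition Θ Θ) (θ : Θ) {P : Θ × M × T → unitInterval}
    (hP : UniversallyMeasurable P) (hle : ∀ x, P x ≤ π.passage (x.2.2, θ)) :
    ∃ σ' : Strategy Θ T M, ∀ B, MeasurableSet B → induced π mech σ' θ B =
      ∫⁻ θ', ∫⁻ ω, lottery (P (θ', ω)) (mech.decision (ω.1, ω.2, true) B)
        (mech.decision (ω.1, ω.2, false) B) ∂(messageTest mech σ θ') ∂(r θ) := by
  let k := r.prod ((messageTest mech σ).comap Prod.snd measurable_snd)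
  have ha : Measurable fun ω : M × T => π.passage (ω.2, θ) :=
    π.measurable_passage.comp (by fun_prop)
  obtain ⟨e, he, hint⟩ := exists_lintegral_lottery_eq (k θ) (hP.aemeasurable _) ha hle
  have he' : UniversallyMeasurable fun x : Θ × M × T => e x.2 :=
    (he.comp measurable_snd).universallyMeasurable
  refine ⟨⟨r.comp σ.report, _, he'⟩, fun B hB => ?_⟩
  have h₁ := mech.universallyMeasurable_decision true hB
  have h₀ := mech.universallyMeasurable_decision false hB
  have hsnd : IsProbabilityMeasure (k θ).snd := inferInstance
  rw [induced_apply _ _ _ _ hB, ← snd_prod_messageTest]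
  refine (hint _ _ (h₁.aemeasurable _) (h₀.aemeasurable _) fun ω => prob_le_one).symm.trans ?_
  exact Transition.lintegral_prod r _ θ
    (hP.lottery (h₁.comp_measurable measurable_snd) (h₀.comp_measurable measurable_snd))

end TestingMechanism

theorem mainTheorem3 {Θ : Type uΘ} {T : Type uT} {X : Type uX}
    [TopologicalSpace Θ] [PolishSpace Θ] [MeasurableSpace Θ] [BorelSpace Θ]
    [TopologicalSpace T] [PolishSpace T] [MeasurableSpace T] [BorelSpace T]
    [TopologicalSpace X] [PolishSpace X] [MeasurableSpace X] [BorelSpace X]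
    (π : PassageRate Θ T) (hπ : Continuous π.passage)
    (That : Θ → Set T) (hclosed : ∀ θ, IsClosed (That θ))
    (hgraph : MeasurableSet {p : Θ × T | p.2 ∈ That p.1})
    (hdisc : MostDiscerning π That)
    (u : X × Θ → ℝ) (hu : Measurable u)
    (f : Transition Θ X) (hf : Implementable.{uΘ, uT, uX, uM} π u f) :
    ∃ that : Transition Θ T, SupportedOn that That ∧
      CanonicallyImplementableWith π u that f := by
  obtain ⟨M, _, _, _, _, mech, σ, hbest, rfl⟩ := hf
  rcases isEmpty_or_nonempty Θ with hΘ | ⟨⟨θ₀⟩⟩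
  · -- Without types every map out of `Θ` is the empty one.
    refine ⟨⟨isEmptyElim, isEmptyElim,
        fun _ _ => (measurable_of_empty _).universallyMeasurable⟩,
      isEmptyElim, ⟨isEmptyElim, isEmptyElim, fun _ _ =>
        (measurable_of_empty _).universallyMeasurable⟩, ⟨Transition.id Θ, isEmptyElim,
        (measurable_of_empty _).universallyMeasurable⟩, ⟨rfl, isEmptyElim⟩,
      fun _ => isEmptyElim, ?_⟩
    exact Transition.eq_of_toFun_eq isEmptyElim
  have hne : Nonempty (M × T) := nonempty_of_isProbabilityMeasure (messageTest mech σ θ₀)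
  obtain ⟨s, a, b, hs, ha, hb, hsel⟩ := hdisc.exists_selection hπ hgraph
  obtain ⟨t, g, ht, hind⟩ := exists_direct_mechanism π mech σ hs ha hb
  let σc : Strategy Θ T Θ := ⟨Transition.id Θ, fun _ => 1, measurable_const.universallyMeasurable⟩
  -- Under truthful reporting and full effort, the conversion reproduces the passage rate on the
  -- original test exactly.
  have htruth : induced π mech σ = induced π ⟨t, g⟩ σc := by
    refine Transition.eq_of_toFun_eq fun θ => Measure.ext fun B hB => ?_
    rw [induced_apply _ _ _ _ hB, hind _ _ _ hB]
    change _ = ∫⁻ θ₁, _ ∂(Measure.dirac θ)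
    rw [lintegral_dirac]
    refine lintegral_congr fun ω => ?_
    congr 1
    rw [passProb, mix_mul_mul, one_mul, (hsel θ ω.2).2.2.1]
  refine ⟨t, fun θ => support_subset_of_lintegral_indicator (ht θ) (hclosed θ)
    fun ω => (hsel θ ω.2).1, g, σc, ⟨rfl, fun _ _ => rfl⟩, fun σ' θ => ?_, htruth⟩
  have hP : UniversallyMeasurable fun x : Θ × M × T =>
      passProb π σ a b σ' θ x.1 (s (x.1, x.2.2)) x.2 := by
    have hsx := hs.comp_measurable (f := fun x : Θ × M × T => (x.1, x.2.2)) (by fun_prop)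
    have hx : UniversallyMeasurable fun x : Θ × M × T => (x.1, s (x.1, x.2.2), x.2) :=
      measurable_fst.universallyMeasurable.prodMk
        (hsx.prodMk measurable_snd.universallyMeasurable)
    have h := (universallyMeasurable_passProb π σ ha hb σ' θ).comp hx
    exact h
  obtain ⟨σ'', hσ''⟩ := exists_strategy_induced_eq π mech σ σ'.report θ hP fun x => by
    -- Reduced effort only lowers the probability of a converted pass, since `b ≤ a`, and with full
    -- effort it is at most the passage rate on the original test.
    obtain ⟨-, hba, -, hle⟩ := hsel x.1 x.2.2
    rw [passProb, mix_mul_mul]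
    exact unitInterval.mul_le_right.trans
      ((mix_mono_left unitInterval.mul_le_right hba).trans (hle θ))
  have heq : induced π ⟨t, g⟩ σ' θ = induced π mech σ'' θ :=
    Measure.ext fun B hB => (hind _ _ _ hB).trans (hσ'' B hB).symm
  rw [heq, ← htruth]
  exact hbest σ'' θ
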